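/- Let $\mathbf k$ be an algebraically closed field of characteristic $0$, let $\mathfrak g,\mathfrak h$ be Lie algebras over $\mathbf k$ (of any dimension), let $\phi:\mathfrak g\to\mathrm{Der}(\mathfrak h)$ be a homomorphism of Lie algebras, and let $T:\mathfrak h\to\mathfrak g$ be a relative Rota–Baxter operator (of weight $1$) with respect to $\phi$, that is, a linear map with $$[T(u),T(v)]_{\mathfrak g}=T\big(\phi(T(u))v-\phi(T(v))u+[u,v]_{\mathfrak h}\big)\qquad(u,v\in\mathfrak h).$$ Let $U(\mathfrak g),U(\mathfrak h)$ be the universal enveloping algebras with their usual Hopf algebra structures (elements of the Lie algebra are primitive), written $\Delta(u)=u_1\otimes u_2$. Let $\bar\phi:U(\mathfrak g)\to\mathrm{End}(U(\mathfrak h))$ be the algebra homomorphism for which $\bar\phi(x)$, $x\in\mathfrak g$, is the derivation of $U(\mathfrak h)$ extending $\phi(x)$, i.e. $\bar\phi(x)(y_1\cdots y_r)=\sum_i y_1\cdots y_{i-1}\,\phi(x)(y_i)\,y_{i+1}\cdots y_r$. It makes $U(\mathfrak h)$ a $U(\mathfrak g)$-module bialgebra: the action is a coalgebra homomorphism $U(\mathfrak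 g)\otimes U(\mathfrak h)\to U(\mathfrak h)$, $\bar\phi(x)(ab)=\bar\phi(x_1)(a)\,\bar\phi(x_2)(b)$ and $\bar\phi(x)(1)=\varepsilon(x)1$. Moreover $y\rhd_T z:=\phi(T(y))z$ is a post-Lie structure on $\mathfrak h$, i.e. $x\rhd_T[y,z]=[x\rhd_T y,z]+[y,x\rhd_T z]$ and $([x,y]+x\rhd_T y-y\rhd_T x)\rhd_T z=x\rhd_T(y\rhd_T z)-y\rhd_T(x\rhd_T z)$. Then there is a linear map $\bar T:U(\mathfrak h)\to U(\mathfrak g)$ with the following properties. 1. $\bar T$ is the unique relative Rota–Baxter operator with respect to $(U(\mathfrak h),\bar\phi)$ that extends $T$: it is the unique coalgebra homomorphism $U(\mathfrak h)\to U(\mathfrak g)$ that satisfies $$\bar T(a)\bar T(b)=\bar T\big(a_1\,\bar\phi(\bar T(a_2))(b)\big)\qquad(a,b\in U(\mathfrak h))$$ and $\bar T(y)=T(y)$ for all $y\in\mathfrak h$. 2. $\bar T$ is the unique linear map satisfying the recursion $$\bar T(1)=1,\qquad \bar T(yu)=T(y)\,\bar T(u)-\bar T\big(\bar\phi(T(y))(u)\big)\qquad(y\in\mathfrak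 h,\ u\in U(\mathfrak h)).$$ 3. The operation $u\rhd_{\bar T}v:=\bar\phi(\bar T(u))(v)$ makes $U(\mathfrak h)$ a post-Hopf algebra: $\rhd_{\bar T}:U(\mathfrak h)\otimes U(\mathfrak h)\to U(\mathfrak h)$ is a coalgebra homomorphism, $x\rhd_{\bar T}(yz)=(x_1\rhd_{\bar T}y)(x_2\rhd_{\bar T}z)$, $x\rhd_{\bar T}(y\rhd_{\bar T}z)=\big(x_1(x_2\rhd_{\bar T}y)\big)\rhd_{\bar T}z$, and $x\mapsto(x\rhd_{\bar T}\cdot)$ is convolution invertible in $\mathrm{Hom}(U(\mathfrak h),\mathrm{End}(U(\mathfrak h)))$. 4. This post-Hopf structure coincides with the extension $\bar\rhd_T$ to $U(\mathfrak h)$ of the post-Lie structure $\rhd_T$, i.e. $\rhd_{\bar T}$ is the one and only bilinear operation $\bar\rhd$ on $U(\mathfrak h)$ such that, for all $x,z\in\mathfrak h$ and $u,v,w\in U(\mathfrak h)$, $$1\,\bar\rhd\,u=u,\quad x\,\bar\rhd\,1=0,\quad x\,\bar\rhd\,(zv)=(x\rhd_T z)v+z(x\,\bar\rhd\,v),\quad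 (xw)\,\bar\rhd\,u=x\,\bar\rhd\,(w\,\bar\rhd\,u)-(x\,\bar\rhd\,w)\,\bar\rhd\,u .$$ -/

import Mathlib

attribute [local instance 100] LieRing.ofAssociativeRing

/-! ### The Hopf algebra structure on a universal enveloping algebra -/

namespace UniversalEnvelopingAlgebra

section Hopf

open scoped TensorProduct

variable (k : Type*) [CommRing k] (L : Type*) [LieRing L] [LieAlgebra k L]

variable {k L} in
theorem induct {P : UniversalEnvelopingAlgebra k L → Prop}
    (algMap : ∀ r, P (algebraMap k _ r)) (gen : ∀ x, P (ι k x))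
    (mul : ∀ a b, P a → P b → P (a * b)) (add : ∀ a b, P a → P b → P (a + b))
    (a : UniversalEnvelopingAlgebra k L) : P a := by
  let S : Subalgebra k (UniversalEnvelopingAlgebra k L) :=
    { carrier := {a | P a}
      mul_mem' := fun {a b} ha hb => mul a b ha hb
      add_mem' := fun {a b} ha hb => add a b ha hb
      algebraMap_mem' := algMap }
  let f : L →ₗ⁅k⁆ S :=
    { toFun := fun x => ⟨ι k x, gen x⟩
      map_add' := fun x y => Subtype.ext (by simp)
      map_smul' := fun c x => Subtype.ext (by simp)
      map_lie' := fun {x y} => Subtype.ext (by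
        change ι k ⁅x, y⁆ = ι k x * ι k y - ι k y * ι k x
        rw [LieHom.map_lie, LieRing.of_associative_ring_bracket]) }
  have h : S.val.comp (lift k f) = AlgHom.id k _ := by
    apply hom_ext
    ext x
    simp only [LieHom.comp_apply, AlgHom.coe_toLieHom, AlgHom.comp_apply, lift_ι_apply]
    rfl
  have h2 := congrArg (fun g : _ →ₐ[k] _ => g a) h
  simp only [AlgHom.comp_apply, AlgHom.id_apply] at h2
  rw [← h2]
  exact (lift k f a).2

variable {k L} in
theorem algHom_ext_ι {A : Type*} [Ring A] [Algebra k A]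
    {f g : UniversalEnvelopingAlgebra k L →ₐ[k] A} (h : ∀ x, f (ι k x) = g (ι k x)) : f = g := by
  apply AlgHom.ext
  intro a
  induction a using induct with
  | algMap r => simp
  | gen x => exact h x
  | mul a b ha hb => rw [map_mul, map_mul, ha, hb]
  | add a b ha hb => rw [map_add, map_add, ha, hb]

/-- The comultiplication of `U(L)`: the algebra homomorphism with
`Δ x = x ⊗ 1 + 1 ⊗ x` for `x ∈ L`. -/
noncomputable def comulHom : UniversalEnvelopingAlgebra k L →ₐ[k]
    UniversalEnvelopingAlgebra k L ⊗[k] UniversalEnvelopingAlgebra k L :=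
  lift k
    { toFun := fun x => ι k x ⊗ₜ[k] 1 + 1 ⊗ₜ[k] ι k x
      map_add' := fun x y => by
        simp only [map_add, TensorProduct.add_tmul, TensorProduct.tmul_add]; abel
      map_smul' := fun c x => by
        simp only [map_smul, TensorProduct.smul_tmul', TensorProduct.tmul_smul, smul_add,
          RingHom.id_apply]
      map_lie' := fun {x y} => by
        simp only [LieHom.map_lie, LieRing.of_associative_ring_bracket, mul_add, add_mul,
          Algebra.TensorProduct.tmul_mul_tmul, one_mul, mul_one, TensorProduct.sub_tmul,
          TensorProduct.tmul_sub]
        abel }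

/-- The counit of `U(L)`: the algebra homomorphism with `ε x = 0` for `x ∈ L`. -/
noncomputable def counitHom : UniversalEnvelopingAlgebra k L →ₐ[k] k :=
  lift k (0 : L →ₗ⁅k⁆ k)

theorem comulHom_ι (x : L) :
    comulHom k L (ι k x) = ι k x ⊗ₜ[k] 1 + 1 ⊗ₜ[k] ι k x := by
  rw [comulHom, lift_ι_apply]; rfl

theorem counitHom_ι (x : L) : counitHom k L (ι k x) = 0 := by
  rw [counitHom, lift_ι_apply]; rfl

noncomputable instance instBialgebra : Bialgebra k (UniversalEnvelopingAlgebra k L) :=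
  .ofAlgHom (comulHom k L) (counitHom k L)
    (by
      refine algHom_ext_ι fun x => ?_
      simp [comulHom_ι, Algebra.TensorProduct.one_def, TensorProduct.add_tmul,
        TensorProduct.tmul_add, -ι_apply]
      abel)
    (by
      refine algHom_ext_ι fun x => ?_
      simp [comulHom_ι, counitHom_ι, -ι_apply])
    (by
      refine algHom_ext_ι fun x => ?_
      simp [comulHom_ι, counitHom_ι, -ι_apply])

theorem comul_ι (x : L) : Coalgebra.comul (R := k) (ι k x) = ι k x ⊗ₜ[k] 1 + 1 ⊗ₜ[k] ι k x :=
  comulHom_ι k L x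

theorem counit_ι (x : L) : Coalgebra.counit (R := k) (ι k x) = 0 :=
  counitHom_ι k L x

/-- The antipode of `U(L)`, as an algebra homomorphism to the opposite algebra with
`x ↦ -x` for `x ∈ L`. -/
noncomputable def antipodeHom :
    UniversalEnvelopingAlgebra k L →ₐ[k] (UniversalEnvelopingAlgebra k L)ᵐᵒᵖ :=
  lift k
    { toFun := fun x => MulOpposite.op (-ι k x)
      map_add' := fun x y => by
        rw [map_add, neg_add, MulOpposite.op_add]
      map_smul' := fun c x => by
        rw [map_smul, ← smul_neg, MulOpposite.op_smul]; rfl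
      map_lie' := fun {x y} => by
        rw [LieHom.map_lie, LieRing.of_associative_ring_bracket,
          LieRing.of_associative_ring_bracket, ← MulOpposite.op_mul, ← MulOpposite.op_mul,
          ← MulOpposite.op_sub]
        simp only [neg_mul_neg, neg_sub] }

/-- The antipode of `U(L)`, as a linear map. -/
noncomputable def antipodeMap :
    UniversalEnvelopingAlgebra k L →ₗ[k] UniversalEnvelopingAlgebra k L :=
  (MulOpposite.opLinearEquiv k).symm.toLinearMap ∘ₗ (antipodeHom k L).toLinearMap

theorem antipodeMap_ι (x : L) : antipodeMap k L (ι k x) = -ι k x := by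
  simp only [antipodeMap, LinearMap.comp_apply, AlgHom.toLinearMap_apply, antipodeHom,
    lift_ι_apply]
  rfl

theorem antipodeMap_mul (a b : UniversalEnvelopingAlgebra k L) :
    antipodeMap k L (a * b) = antipodeMap k L b * antipodeMap k L a := by
  simp [antipodeMap]

theorem antipodeMap_algebraMap (r : k) :
    antipodeMap k L (algebraMap k _ r) = algebraMap k _ r := by
  simp [antipodeMap]

noncomputable instance instHopfAlgebra : HopfAlgebra k (UniversalEnvelopingAlgebra k L) where
  antipode := antipodeMap k L
  mul_antipode_rTensor_comul := by
    refine LinearMap.ext fun a => ?_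
    simp only [LinearMap.comp_apply, Algebra.linearMap_apply]
    induction a using induct with
    | algMap r =>
      simp [Bialgebra.comul_algebraMap, Algebra.TensorProduct.algebraMap_apply,
        antipodeMap_algebraMap]
    | gen x =>
      simp only [comul_ι, counit_ι, map_add, LinearMap.rTensor_tmul, LinearMap.mul'_apply,
        antipodeMap_ι, mul_one, map_zero]
      have : antipodeMap k L 1 = 1 := by simpa using antipodeMap_algebraMap k L 1
      simp [this]
    | add a b ha hb => simp only [map_add, ha, hb]
    | mul a b ha hb =>
      have key : ∀ s t : UniversalEnvelopingAlgebra k L ⊗[k] UniversalEnvelopingAlgebra k L,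
          ∀ r : k, LinearMap.mul' k _ ((antipodeMap k L).rTensor _ s) = algebraMap k _ r →
          LinearMap.mul' k _ ((antipodeMap k L).rTensor _ (s * t)) =
            r • LinearMap.mul' k _ ((antipodeMap k L).rTensor _ t) := by
        intro s t r hs
        induction t using TensorProduct.induction_on with
        | zero => simp
        | add t u ht hu => simp only [mul_add, map_add, ht, hu, smul_add]
        | tmul b c =>
          have : ∀ s : UniversalEnvelopingAlgebra k L ⊗[k] UniversalEnvelopingAlgebra k L,
              LinearMap.mul' k _ ((antipodeMap k L).rTensor _ (s * (b ⊗ₜ[k] c))) =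
              antipodeMap k L b * LinearMap.mul' k _ ((antipodeMap k L).rTensor _ s) * c := by
            intro s
            induction s using TensorProduct.induction_on with
            | zero => simp
            | add t u ht hu => simp only [mul_add, add_mul, map_add, ht, hu]
            | tmul d e => simp [antipodeMap_mul, mul_assoc]
          rw [this, hs, ← Algebra.commutes, mul_assoc, ← Algebra.smul_def]
          simp
      rw [Bialgebra.comul_mul, key _ _ _ ha, hb, Bialgebra.counit_mul, map_mul, Algebra.smul_def]
  mul_antipode_lTensor_comul := by
    refine LinearMap.ext fun a => ?_
    simp only [LinearMap.comp_apply, Algebra.linearMap_apply]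
    induction a using induct with
    | algMap r =>
      have : antipodeMap k L 1 = 1 := by simpa using antipodeMap_algebraMap k L 1
      simp [Bialgebra.comul_algebraMap, Algebra.TensorProduct.algebraMap_apply, this]
    | gen x =>
      simp only [comul_ι, counit_ι, map_add, LinearMap.lTensor_tmul, LinearMap.mul'_apply,
        antipodeMap_ι, one_mul, map_zero]
      have : antipodeMap k L 1 = 1 := by simpa using antipodeMap_algebraMap k L 1
      simp [this]
    | add a b ha hb => simp only [map_add, ha, hb]
    | mul a b ha hb =>
      have key : ∀ s t : UniversalEnvelopingAlgebra k L ⊗[k] UniversalEnvelopingAlgebra k L,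
          ∀ r : k, LinearMap.mul' k _ ((antipodeMap k L).lTensor _ t) = algebraMap k _ r →
          LinearMap.mul' k _ ((antipodeMap k L).lTensor _ (s * t)) =
            r • LinearMap.mul' k _ ((antipodeMap k L).lTensor _ s) := by
        intro s t r hs
        induction s using TensorProduct.induction_on with
        | zero => simp
        | add t u ht hu => simp only [add_mul, map_add, ht, hu, smul_add]
        | tmul b c =>
          have : ∀ s : UniversalEnvelopingAlgebra k L ⊗[k] UniversalEnvelopingAlgebra k L,
              LinearMap.mul' k _ ((antipodeMap k L).lTensor _ ((b ⊗ₜ[k] c) * s)) =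
              b * LinearMap.mul' k _ ((antipodeMap k L).lTensor _ s) * antipodeMap k L c := by
            intro s
            induction s using TensorProduct.induction_on with
            | zero => simp
            | add t u ht hu => simp only [mul_add, add_mul, map_add, ht, hu]
            | tmul d e => simp [antipodeMap_mul, mul_assoc]
          rw [this, hs, ← Algebra.commutes, mul_assoc, ← Algebra.smul_def]
          simp
      rw [Bialgebra.comul_mul, key _ _ _ hb, ha, Bialgebra.counit_mul, map_mul, Algebra.smul_def,
        Algebra.commutes]

end Hopf

/-! ### Extension of derivations and of actions by derivations -/

section Action

variable {k : Type*} [CommRing k] {L : Type*} [LieRing L] [LieAlgebra k L]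
  {M : Type*} [LieRing M] [LieAlgebra k M]

/-- The algebra homomorphism `U(M) → U(M) ⊕ ε U(M)` (with `ε² = 0`) such that
`y ↦ y + ε D(y)` for `y ∈ M`. -/
noncomputable def derHom (D : LieDerivation k M M) :
    UniversalEnvelopingAlgebra k M →ₐ[k]
      TrivSqZeroExt (UniversalEnvelopingAlgebra k M) (UniversalEnvelopingAlgebra k M) :=
  lift k
    { toFun := fun y => TrivSqZeroExt.inl (ι k y) + TrivSqZeroExt.inr (ι k (D y))
      map_add' := fun x y => by
        ext <;> simp [-ι_apply]
      map_smul' := fun c x => by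
        ext <;> simp [-ι_apply]
      map_lie' := fun {x y} => by
        ext
        · simp [-ι_apply, LieRing.of_associative_ring_bracket]
        · simp [-ι_apply, LieRing.of_associative_ring_bracket]
          abel }

/-- The derivation of the associative algebra `U(M)` that extends a derivation `D` of the Lie
algebra `M`; on products of elements of `M` it is given by
`y₁ ⋯ yᵣ ↦ ∑ᵢ y₁ ⋯ yᵢ₋₁ D(yᵢ) yᵢ₊₁ ⋯ yᵣ`, see `extDer_ι`, `extDer_one` and `extDer_mul`. -/
noncomputable def extDer (D : LieDerivation k M M) :
    Module.End k (UniversalEnvelopingAlgebra k M) where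
  toFun a := (derHom D a).snd
  map_add' a b := by simp
  map_smul' c a := by simp

theorem derHom_fst (D : LieDerivation k M M) (a : UniversalEnvelopingAlgebra k M) :
    (derHom D a).fst = a := by
  have h : (TrivSqZeroExt.fstHom k _ _).comp (derHom D) = AlgHom.id k _ := by
    apply hom_ext
    ext x
    simp only [LieHom.comp_apply, AlgHom.coe_toLieHom, AlgHom.comp_apply, derHom, lift_ι_apply]
    simp [-ι_apply]
  exact congrArg (fun g : _ →ₐ[k] _ => g a) h

theorem extDer_ι (D : LieDerivation k M M) (y : M) : extDer D (ι k y) = ι k (D y) := by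
  change (derHom D (ι k y)).snd = _
  rw [derHom, lift_ι_apply]
  simp [-ι_apply]

theorem extDer_one (D : LieDerivation k M M) : extDer D 1 = 0 := by
  change (derHom D 1).snd = _
  simp

theorem extDer_algebraMap (D : LieDerivation k M M) (r : k) :
    extDer D (algebraMap k _ r) = 0 := by
  rw [Algebra.algebraMap_eq_smul_one, map_smul, extDer_one, smul_zero]

theorem extDer_mul (D : LieDerivation k M M) (a b : UniversalEnvelopingAlgebra k M) :
    extDer D (a * b) = extDer D a * b + a * extDer D b := by
  change (derHom D (a * b)).snd = (derHom D a).snd * b + a * (derHom D b).snd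
  simp [derHom_fst, add_comm]

/-- The extension `φ̄ : U(L) → End(U(M))` of an action `φ : L → Der(M)` of a Lie algebra `L` on a
Lie algebra `M` by derivations: `φ̄` is a homomorphism of algebras, and for `x ∈ L` the map `φ̄(x)`
is the derivation of `U(M)` that extends `φ(x)`. -/
noncomputable def extAction (φ : L →ₗ⁅k⁆ LieDerivation k M M) :
    UniversalEnvelopingAlgebra k L →ₐ[k] Module.End k (UniversalEnvelopingAlgebra k M) :=
  lift k
    { toFun := fun x => extDer (φ x)
      map_add' := fun x y => by
        refine LinearMap.ext fun a => ?_
        rw [LinearMap.add_apply]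
        induction a using induct with
        | algMap r => simp only [extDer_algebraMap, add_zero]
        | gen x => simp only [extDer_ι, map_add, LieDerivation.add_apply]
        | mul a b ha hb => simp only [extDer_mul, ha, hb, mul_add, add_mul]; abel
        | add a b ha hb => simp only [map_add (extDer _), ha, hb]; abel
      map_smul' := fun c x => by
        refine LinearMap.ext fun a => ?_
        rw [LinearMap.smul_apply]
        induction a using induct with
        | algMap r => simp only [extDer_algebraMap, smul_zero]
        | gen x => simp only [extDer_ι, map_smul, LieDerivation.smul_apply, RingHom.id_apply]
        | mul a b ha hb =>
          simp only [extDer_mul, ha, hb, smul_add, smul_mul_assoc, mul_smul_comm]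
        | add a b ha hb => simp only [map_add (extDer _), ha, hb, smul_add]
      map_lie' := fun {x y} => by
        refine LinearMap.ext fun a => ?_
        rw [LieRing.of_associative_ring_bracket, LinearMap.sub_apply, Module.End.mul_apply,
          Module.End.mul_apply]
        induction a using induct with
        | algMap r => simp only [extDer_algebraMap, map_zero, sub_zero]
        | gen x => simp only [extDer_ι, LieHom.map_lie, LieDerivation.lie_apply, map_sub]
        | mul a b ha hb =>
          simp only [extDer_mul, ha, hb, map_add (extDer _), mul_sub, sub_mul]; abel
        | add a b ha hb => simp only [map_add (extDer _), ha, hb]; abel }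

theorem extAction_ι (φ : L →ₗ⁅k⁆ LieDerivation k M M) (x : L) :
    extAction φ (ι k x) = extDer (φ x) := by
  rw [extAction, lift_ι_apply]; rfl

end Action

end UniversalEnvelopingAlgebra

/-! ### Post-Lie algebras, post-Hopf algebras and relative Rota–Baxter operators -/

section Notions

open scoped TensorProduct

/-- A linear map `T : 𝔥 → 𝔤` is a relative Rota–Baxter operator (of weight 1) on the Lie algebra
`𝔤` with respect to the action `φ : 𝔤 → Der(𝔥)`. -/
def IsLieRelRotaBaxter {k 𝔤 𝔥 : Type*} [CommRing k] [LieRing 𝔤] [LieAlgebra k 𝔤]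
    [LieRing 𝔥] [LieAlgebra k 𝔥] (φ : 𝔤 →ₗ⁅k⁆ LieDerivation k 𝔥 𝔥) (T : 𝔥 →ₗ[k] 𝔤) : Prop :=
  ∀ u v : 𝔥, ⁅T u, T v⁆ = T (φ (T u) v - φ (T v) u + ⁅u, v⁆)

/-- A bilinear operation `x ▷ y = p x y` makes the Lie algebra `L` a post-Lie algebra. -/
structure IsPostLie {k L : Type*} [CommRing k] [LieRing L] [LieAlgebra k L]
    (p : L →ₗ[k] L →ₗ[k] L) : Prop where
  lie_right : ∀ x y z : L, p x ⁅y, z⁆ = ⁅p x y, z⁆ + ⁅y, p x z⁆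
  lie_left : ∀ x y z : L, p (⁅x, y⁆ + p x y - p y x) z = p x (p y z) - p y (p x z)

/-- The operation `u ▷ v = φ(T u) v` on `𝔥`. -/
def liePostProduct {k 𝔤 𝔥 : Type*} [CommRing k] [LieRing 𝔤] [LieAlgebra k 𝔤]
    [LieRing 𝔥] [LieAlgebra k 𝔥] (φ : 𝔤 →ₗ⁅k⁆ LieDerivation k 𝔥 𝔥) (T : 𝔥 →ₗ[k] 𝔤) :
    𝔥 →ₗ[k] 𝔥 →ₗ[k] 𝔥 :=
  LinearMap.mk₂ k (fun u v => φ (T u) v)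
    (fun _ _ _ => by simp) (fun _ _ _ => by simp) (fun _ _ _ => by simp) (fun _ _ _ => by simp)

/-- A linear map is a homomorphism of coalgebras. -/
def IsCoalgHom {k C D : Type*} [CommRing k] [AddCommGroup C] [Module k C] [Coalgebra k C]
    [AddCommGroup D] [Module k D] [Coalgebra k D] (f : C →ₗ[k] D) : Prop :=
  Coalgebra.counit ∘ₗ f = Coalgebra.counit (R := k) (A := C) ∧
    TensorProduct.map f f ∘ₗ Coalgebra.comul = Coalgebra.comul ∘ₗ f

/-- `sweedler f a` is `f(a₁, a₂)` in Sweedler notation, for a bilinear map `f`. -/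
noncomputable def sweedler {k C V : Type*} [CommRing k] [AddCommGroup C] [Module k C]
    [Coalgebra k C] [AddCommGroup V] [Module k V] (f : C →ₗ[k] C →ₗ[k] V) : C →ₗ[k] V :=
  TensorProduct.lift f ∘ₗ Coalgebra.comul

theorem sweedler_apply {k C V ι : Type*} [CommRing k] [AddCommGroup C] [Module k C]
    [Coalgebra k C] [AddCommGroup V] [Module k V] (f : C →ₗ[k] C →ₗ[k] V) {a : C}
    (r : Coalgebra.Repr k a ι) :
    sweedler f a = ∑ i ∈ r.index, f (r.left i) (r.right i) := by
  simp [sweedler, ← r.eq]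

/-- The algebra homomorphism `act : H → End(K)`, written `x ⇀ a = act x a`, makes the bialgebra `K`
a left `H`-module bialgebra. -/
structure IsModuleBialgebra {k H K : Type*} [CommRing k] [Ring H] [Bialgebra k H]
    [Ring K] [Bialgebra k K] (act : H →ₐ[k] Module.End k K) : Prop where
  /-- `x ⇀ (a b) = (x₁ ⇀ a) (x₂ ⇀ b)` -/
  act_mul : ∀ (x : H) (a b : K), act x (a * b) =
    sweedler ((LinearMap.mul k K).compl₁₂ (act.toLinearMap.flip a) (act.toLinearMap.flip b)) x
  /-- `x ⇀ 1 = ε(x) 1` -/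
  act_one : ∀ x : H, act x 1 = Coalgebra.counit (R := k) x • (1 : K)
  /-- `⇀ : H ⊗ K → K` is a homomorphism of coalgebras. -/
  isCoalgHom : IsCoalgHom (TensorProduct.lift act.toLinearMap)

/-- `K` is an `H`-module bialgebra via `act`, written `⇀`, and `T : K → H` is a relative
Rota–Baxter operator with respect to it: a homomorphism of coalgebras such that
`T(a) T(b) = T(a₁ (T(a₂) ⇀ b))`. -/
structure IsRelRotaBaxter {k H K : Type*} [CommRing k] [Ring H] [HopfAlgebra k H]
    [Ring K] [HopfAlgebra k K] (act : H →ₐ[k] Module.End k K) (T : K →ₗ[k] H) : Prop where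
  isModuleBialgebra : IsModuleBialgebra act
  isCoalgHom : IsCoalgHom T
  map_mul_map : ∀ a b : K,
    T a * T b = T (sweedler ((LinearMap.mul k K).compl₂ (act.toLinearMap.flip b ∘ₗ T)) a)

/-- The bilinear operation `a ▷ b = T(a) ⇀ b` on `K`. -/
noncomputable def hopfPostProduct {k H K : Type*} [CommRing k] [Ring H] [Algebra k H]
    [AddCommGroup K] [Module k K] (act : H →ₐ[k] Module.End k K) (T : K →ₗ[k] H) :
    K →ₗ[k] K →ₗ[k] K :=
  act.toLinearMap ∘ₗ T

/-- A bilinear operation `x ▷ y = p x y` makes the Hopf algebra `H` a post-Hopf algebra. -/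
structure IsPostHopf {k H : Type*} [CommRing k] [Ring H] [HopfAlgebra k H]
    (p : H →ₗ[k] H →ₗ[k] H) : Prop where
  /-- `▷ : H ⊗ H → H` is a homomorphism of coalgebras. -/
  isCoalgHom : IsCoalgHom (TensorProduct.lift p)
  /-- `x ▷ (y z) = (x₁ ▷ y) (x₂ ▷ z)` -/
  mul_right : ∀ x y z : H,
    p x (y * z) = sweedler ((LinearMap.mul k H).compl₁₂ (p.flip y) (p.flip z)) x
  /-- `x ▷ (y ▷ z) = (x₁ (x₂ ▷ y)) ▷ z` -/
  assoc : ∀ x y z : H,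
    p x (p y z) = p (sweedler ((LinearMap.mul k H).compl₂ (p.flip y)) x) z
  /-- `x ↦ (x ▷ ·)` is convolution invertible in `Hom(H, End(H))`. -/
  convInvertible : IsUnit (WithConv.toConv (p : H →ₗ[k] Module.End k H))

/-- The bilinear operation `x ▷̄ u = P x u` on `U(L)` is the extension of the operation
`x ▷ y = p x y` on the Lie algebra `L`, in the sense that for all `x, z ∈ L` and `u, v, w ∈ U(L)`:
`1 ▷̄ u = u`, `x ▷̄ 1 = 0`, `x ▷̄ (z v) = (x ▷ z) v + z (x ▷̄ v)` and
`(x w) ▷̄ u = x ▷̄ (w ▷̄ u) - (x ▷̄ w) ▷̄ u`. -/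
structure IsPostExtension {k L : Type*} [CommRing k] [LieRing L] [LieAlgebra k L]
    (p : L →ₗ[k] L →ₗ[k] L)
    (P : UniversalEnvelopingAlgebra k L →ₗ[k] UniversalEnvelopingAlgebra k L →ₗ[k]
      UniversalEnvelopingAlgebra k L) : Prop where
  one_left : ∀ u, P 1 u = u
  ι_one : ∀ x : L, P (UniversalEnvelopingAlgebra.ι k x) 1 = 0
  ι_mul : ∀ (x z : L) (v : UniversalEnvelopingAlgebra k L),
    P (UniversalEnvelopingAlgebra.ι k x) (UniversalEnvelopingAlgebra.ι k z * v) =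
      UniversalEnvelopingAlgebra.ι k (p x z) * v +
        UniversalEnvelopingAlgebra.ι k z * P (UniversalEnvelopingAlgebra.ι k x) v
  mul_left : ∀ (x : L) (w u : UniversalEnvelopingAlgebra k L),
    P (UniversalEnvelopingAlgebra.ι k x * w) u =
      P (UniversalEnvelopingAlgebra.ι k x) (P w u) - P (P (UniversalEnvelopingAlgebra.ι k x) w) u

end Notions

/-!
Write `⇀` for the action `extAction φ` of `U(𝔤)` on `U(𝔥)`.

*Uniqueness.* Derivations of `U(𝔥)` that come from `𝔥` do not raise the degree, so `1` generates
`U(𝔥)` under the operators `u ↦ y u + T(y) ⇀ u`, `y ∈ 𝔥`. The recursion says that `T̄` intertwines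
these operators with left multiplication by `T(y)`. They are coderivations, hence linear identities,
such as those defining a coalgebra homomorphism or the Rota–Baxter identity, can be checked along
them. Conversely, the Rota–Baxter identity at a primitive element is the recursion.

*Existence.* The recursion cannot serve as a definition directly, since `U(𝔥)` is a quotient of a
tensor algebra. But if `T̄` exists, then `Ψ_u(x) = T̄(x ⇀ u)` satisfies `Ψ_{yu} = L_y Ψ_u`, where
`(L_y Ψ)(x) = T(x₁ ⇀ y) Ψ(x₂) - Ψ(T(x₁ ⇀ y) x₂)` makes no reference to `T̄`. The Rota–Baxter
identity for `T` says exactly that `y ↦ L_y` is a representation of `𝔥` on `Hom(U(𝔤), U(𝔤))`. It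
extends to `U(𝔥)`, and `T̄(u)` is recovered as the value at `1` of `u` acting on the counit.
-/

section Coalgebra

open scoped TensorProduct

variable {k C D E V W : Type*} [CommRing k] [AddCommGroup C] [Module k C] [Coalgebra k C]
  [AddCommGroup D] [Module k D] [Coalgebra k D] [AddCommGroup E] [Module k E] [Coalgebra k E]
  [AddCommGroup V] [Module k V] [AddCommGroup W] [Module k W]

/-- The linear map `f ↦ sweedler f`. -/
noncomputable def sweedlerHom : (C →ₗ[k] C →ₗ[k] V) →ₗ[k] C →ₗ[k] V :=
  LinearMap.lcomp k V Coalgebra.comul ∘ₗ (TensorProduct.lift.equiv (.id k) C C V).toLinearMap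

theorem sweedlerHom_apply (f : C →ₗ[k] C →ₗ[k] V) : sweedlerHom f = sweedler f := rfl

theorem sweedler_add (f g : C →ₗ[k] C →ₗ[k] V) : sweedler (f + g) = sweedler f + sweedler g :=
  map_add sweedlerHom f g

theorem map_sweedler (g : V →ₗ[k] W) (f : C →ₗ[k] C →ₗ[k] V) (a : C) :
    g (sweedler f a) = sweedler (f.compr₂ g) a := by
  simp [sweedler_apply _ (Coalgebra.Repr.arbitrary k a)]

theorem sweedler_counit_mul (g : C →ₗ[k] k) (a : C) :
    sweedler ((LinearMap.mul k k).compl₁₂ Coalgebra.counit g) a = g a := by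
  let r := Coalgebra.Repr.arbitrary k a
  calc sweedler ((LinearMap.mul k k).compl₁₂ Coalgebra.counit g) a
      = ∑ i ∈ r.index, TensorProduct.lift ((LinearMap.mul k k).compl₂ g)
          (Coalgebra.counit (r.left i) ⊗ₜ r.right i) := sweedler_apply _ r
    _ = 1 * g a := by rw [← map_sum, Coalgebra.sum_counit_tmul_eq]; rfl
    _ = g a := one_mul _

theorem sweedler_mul_counit (g : C →ₗ[k] k) (a : C) :
    sweedler ((LinearMap.mul k k).compl₁₂ g Coalgebra.counit) a = g a := by
  let r := Coalgebra.Repr.arbitrary k a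
  calc sweedler ((LinearMap.mul k k).compl₁₂ g Coalgebra.counit) a
      = ∑ i ∈ r.index, TensorProduct.lift (LinearMap.mul k k ∘ₗ g)
          (r.left i ⊗ₜ Coalgebra.counit (r.right i)) := sweedler_apply _ r
    _ = g a * 1 := by rw [← map_sum, Coalgebra.sum_tmul_counit_eq]; rfl
    _ = g a := mul_one _

namespace IsCoalgHom

/-- A linear map satisfying `IsCoalgHom`, as a bundled homomorphism of coalgebras. -/
def toCoalgHom {F : C →ₗ[k] D} (hF : IsCoalgHom F) : C →ₗc[k] D :=
  { F with counit_comp := hF.1, map_comp_comul := hF.2 }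

theorem of_coalgHom (F : C →ₗc[k] D) : IsCoalgHom F.toLinearMap :=
  ⟨F.counit_comp, F.map_comp_comul⟩

theorem comp {G : D →ₗ[k] E} {F : C →ₗ[k] D} (hG : IsCoalgHom G) (hF : IsCoalgHom F) :
    IsCoalgHom (G ∘ₗ F) :=
  of_coalgHom (hG.toCoalgHom.comp hF.toCoalgHom)

theorem rTensor {F : C →ₗ[k] D} (hF : IsCoalgHom F) : IsCoalgHom (F.rTensor E) :=
  of_coalgHom (Coalgebra.TensorProduct.map hF.toCoalgHom (CoalgHom.id k E))

theorem sweedler_map {F : C →ₗ[k] D} (hF : IsCoalgHom F) (f : D →ₗ[k] D →ₗ[k] V) (a : C) :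
    sweedler f (F a) = sweedler (f.compl₁₂ F F) a := by
  calc sweedler f (F a) = (TensorProduct.lift f ∘ₗ TensorProduct.map F F) (Coalgebra.comul a) :=
        congrArg (TensorProduct.lift f) (LinearMap.congr_fun hF.2 a).symm
    _ = sweedler (f.compl₁₂ F F) a := by rw [TensorProduct.lift_comp_map]; rfl

theorem isUnit_toConv_comp {A : Type*} [Ring A] [Algebra k A] {F : C →ₗ[k] D} (hF : IsCoalgHom F)
    {f : D →ₗ[k] A} (hf : IsUnit (WithConv.toConv f)) : IsUnit (WithConv.toConv (f ∘ₗ F)) := by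
  let precomp : WithConv (D →ₗ[k] A) →* WithConv (C →ₗ[k] A) :=
    { toFun g := .toConv (g.ofConv ∘ₗ hF.toCoalgHom.toLinearMap)
      map_one' := WithConv.ofConv_injective <| LinearMap.ext fun c =>
        congrArg (algebraMap k A) (LinearMap.congr_fun hF.1 c)
      map_mul' g g' := WithConv.ofConv_injective (LinearMap.convMul_comp_coalgHom_distrib g g' _) }
  exact hf.map precomp

end IsCoalgHom

theorem isUnit_toConv_algHom {H A : Type*} [Ring H] [HopfAlgebra k H] [Ring A] [Algebra k A]
    (h : H →ₐ[k] A) : IsUnit (WithConv.toConv h.toLinearMap) := by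
  let postcomp : WithConv (H →ₗ[k] H) →* WithConv (H →ₗ[k] A) :=
    { toFun g := .toConv (h.toLinearMap ∘ₗ g.ofConv)
      map_one' := WithConv.ofConv_injective <| LinearMap.ext fun c => h.commutes _
      map_mul' g g' := WithConv.ofConv_injective (LinearMap.algHom_comp_convMul_distrib h g g') }
  have hid : IsUnit (WithConv.toConv (LinearMap.id (R := k) (M := H))) :=
    ⟨⟨_, _, LinearMap.id_mul_antipode, LinearMap.antipode_mul_id⟩, rfl⟩
  exact hid.map postcomp

/-- Coderivations of a coalgebra: the linear maps `Q` with
`Δ(Q a) = Q a₁ ⊗ a₂ + a₁ ⊗ Q a₂`. -/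
def IsCoderivation (Q : C →ₗ[k] C) : Prop :=
  ∀ a, Coalgebra.comul (R := k) (Q a) =
    Q.rTensor C (Coalgebra.comul a) + Q.lTensor C (Coalgebra.comul a)

namespace IsCoderivation

variable {Q Q' : C →ₗ[k] C}

theorem add (hQ : IsCoderivation Q) (hQ' : IsCoderivation Q') : IsCoderivation (Q + Q') := by
  intro a
  rw [LinearMap.add_apply, map_add, hQ, hQ', LinearMap.rTensor_add, LinearMap.lTensor_add,
    LinearMap.add_apply, LinearMap.add_apply, add_add_add_comm]

theorem sweedler_apply (hQ : IsCoderivation Q) (f : C →ₗ[k] C →ₗ[k] V) (a : C) :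
    sweedler f (Q a) = sweedler (f ∘ₗ Q) a + sweedler (f.compl₂ Q) a := by
  have hr : TensorProduct.lift (f ∘ₗ Q) = TensorProduct.lift f ∘ₗ Q.rTensor C :=
    TensorProduct.ext' fun _ _ => rfl
  have hl : TensorProduct.lift (f.compl₂ Q) = TensorProduct.lift f ∘ₗ Q.lTensor C :=
    TensorProduct.ext' fun _ _ => rfl
  simp only [sweedler, hr, hl, LinearMap.comp_apply, hQ a, map_add]

theorem counit_apply (hQ : IsCoderivation Q) (a : C) : Coalgebra.counit (R := k) (Q a) = 0 := by
  have h := hQ.sweedler_apply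
    ((LinearMap.mul k k).compl₁₂ Coalgebra.counit Coalgebra.counit) a
  rw [sweedler_counit_mul] at h
  exact left_eq_add.mp (h.trans (congrArg₂ (· + ·) (sweedler_mul_counit (Coalgebra.counit ∘ₗ Q) a)
    (sweedler_counit_mul (Coalgebra.counit ∘ₗ Q) a)))

theorem comul_map_apply {P : D →ₗ[k] D} (hQ : IsCoderivation Q) (hP : IsCoderivation P)
    {F : C →ₗ[k] D} (hF : F ∘ₗ Q = P ∘ₗ F) {a : C}
    (ha : TensorProduct.map F F (Coalgebra.comul (R := k) a) = Coalgebra.comul (F a)) :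
    TensorProduct.map F F (Coalgebra.comul (R := k) (Q a)) = Coalgebra.comul (F (Q a)) := by
  have hr : TensorProduct.map F F ∘ₗ Q.rTensor C = P.rTensor D ∘ₗ TensorProduct.map F F := by
    rw [LinearMap.map_comp_rTensor, hF, LinearMap.rTensor_comp_map]
  have hl : TensorProduct.map F F ∘ₗ Q.lTensor C = P.lTensor D ∘ₗ TensorProduct.map F F := by
    rw [LinearMap.map_comp_lTensor, hF, LinearMap.lTensor_comp_map]
  calc TensorProduct.map F F (Coalgebra.comul (R := k) (Q a))
      = (TensorProduct.map F F ∘ₗ Q.rTensor C) (Coalgebra.comul a) +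
          (TensorProduct.map F F ∘ₗ Q.lTensor C) (Coalgebra.comul a) := by rw [hQ, map_add]; rfl
    _ = Coalgebra.comul (P (F a)) := by rw [hr, hl, hP, ← ha]; rfl
    _ = Coalgebra.comul (F (Q a)) := congrArg _ (LinearMap.congr_fun hF a).symm

end IsCoderivation

end Coalgebra

section Bialgebra

open scoped TensorProduct

variable {k B V : Type*} [CommRing k] [Ring B] [Bialgebra k B] [AddCommGroup V] [Module k V]

theorem sweedler_one (f : B →ₗ[k] B →ₗ[k] V) : sweedler f 1 = f 1 1 := by
  simp [sweedler, Algebra.TensorProduct.one_def]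

variable (k) in
/-- Primitive elements of a bialgebra: those on which `Δ` is given by `Δ x = x ⊗ 1 + 1 ⊗ x`. -/
def IsPrimitiveElem (x : B) : Prop :=
  Coalgebra.comul (R := k) x = x ⊗ₜ[k] 1 + 1 ⊗ₜ[k] x

namespace IsPrimitiveElem

variable {x : B}

theorem sweedler_apply (hx : IsPrimitiveElem k x) (f : B →ₗ[k] B →ₗ[k] V) :
    sweedler f x = f x 1 + f 1 x := by
  rw [sweedler, LinearMap.comp_apply, hx, map_add, TensorProduct.lift.tmul, TensorProduct.lift.tmul]

theorem isCoderivation_mulLeft (hx : IsPrimitiveElem k x) :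
    IsCoderivation (LinearMap.mulLeft k x) := by
  intro a
  rw [LinearMap.mulLeft_apply, Bialgebra.comul_mul, hx, add_mul]
  congr 1 <;>
  · induction Coalgebra.comul (R := k) a using TensorProduct.induction_on with
    | zero => simp
    | tmul p q => simp
    | add s t hs ht => rw [mul_add, map_add, hs, ht]

theorem isCoderivation_mulRight (hx : IsPrimitiveElem k x) :
    IsCoderivation (LinearMap.mulRight k x) := by
  intro a
  rw [LinearMap.mulRight_apply, Bialgebra.comul_mul, hx, mul_add]
  congr 1 <;>
  · induction Coalgebra.comul (R := k) a using TensorProduct.induction_on with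
    | zero => simp
    | tmul p q => simp
    | add s t hs ht => rw [add_mul, map_add, hs, ht]

end IsPrimitiveElem

end Bialgebra

section RelRotaBaxter

section Bialgebra

variable {k H K : Type*} [CommRing k] [Ring H] [Algebra k H] [Ring K] [Bialgebra k K]
  {act : H →ₐ[k] Module.End k K} {F : K →ₗ[k] H}

variable (act F) in
/-- The map `a ↦ a₁ (F(a₂) ⇀ b)`. It is right multiplication by `b` in the sub-adjacent product of
`K` when `F` is a relative Rota–Baxter operator. -/
noncomputable def subadjacentMulRight (b : K) : Module.End k K :=
  sweedler ((LinearMap.mul k K).compl₂ (act.toLinearMap.flip b ∘ₗ F))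

theorem subadjacentMulRight_one (b : K) : subadjacentMulRight act F b 1 = act (F 1) b :=
  (sweedler_one _).trans (one_mul _)

theorem subadjacentMulRight_of_isPrimitiveElem {y : K} (hy : IsPrimitiveElem k y) (b : K) :
    subadjacentMulRight act F b y = y * act (F 1) b + act (F y) b :=
  (hy.sweedler_apply _).trans (congrArg _ (one_mul _))

end Bialgebra

variable {k H K : Type*} [CommRing k] [Ring H] [HopfAlgebra k H] [Ring K] [HopfAlgebra k K]
  {act : H →ₐ[k] Module.End k K} {F : K →ₗ[k] H}

namespace IsRelRotaBaxter

theorem map_subadjacentMulRight (hF : IsRelRotaBaxter act F) (a b : K) :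
    F (subadjacentMulRight act F b a) = F a * F b :=
  (hF.map_mul_map a b).symm

theorem isGroupLikeElem_map_one (hF : IsRelRotaBaxter act F) : IsGroupLikeElem k (F 1) where
  counit_eq_one := by
    rw [← Bialgebra.counit_one (R := k) (A := K), ← hF.isCoalgHom.1, LinearMap.comp_apply]
  comul_eq_tmul_self := by
    rw [← LinearMap.comp_apply, ← hF.isCoalgHom.2, LinearMap.comp_apply, Bialgebra.comul_one]
    rfl

/-- `F 1` is group-like, hence invertible, and the Rota–Baxter identity makes it idempotent. -/
theorem map_one (hF : IsRelRotaBaxter act F) : F 1 = 1 := by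
  have hidem : F 1 * F 1 = F 1 := by
    rw [← hF.map_subadjacentMulRight, subadjacentMulRight_one, hF.isModuleBialgebra.act_one,
      hF.isGroupLikeElem_map_one.counit_eq_one, one_smul]
  exact hF.isGroupLikeElem_map_one.isUnit.mul_eq_left.mp hidem

theorem map_mul_of_isPrimitiveElem (hF : IsRelRotaBaxter act F) {y : K}
    (hy : IsPrimitiveElem k y) (u : K) : F (y * u) = F y * F u - F (act (F y) u) := by
  rw [← hF.map_subadjacentMulRight, subadjacentMulRight_of_isPrimitiveElem hy, hF.map_one,
    _root_.map_one, Module.End.one_apply, map_add, add_sub_cancel_right]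

theorem isPostHopf (hF : IsRelRotaBaxter act F) : IsPostHopf (hopfPostProduct act F) where
  isCoalgHom := by
    have h : TensorProduct.lift (hopfPostProduct act F) =
        TensorProduct.lift act.toLinearMap ∘ₗ F.rTensor K := TensorProduct.ext' fun _ _ => rfl
    rw [h]
    exact hF.isModuleBialgebra.isCoalgHom.comp hF.isCoalgHom.rTensor
  mul_right x y z :=
    (hF.isModuleBialgebra.act_mul (F x) y z).trans (hF.isCoalgHom.sweedler_map _ x)
  assoc x y z := by
    change act (F x) (act (F y) z) = act (F _) z
    rw [← Module.End.mul_apply, ← map_mul, hF.map_mul_map]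
    rfl
  convInvertible := hF.isCoalgHom.isUnit_toConv_comp (isUnit_toConv_algHom act)

end IsRelRotaBaxter

end RelRotaBaxter

section Derivation

open scoped TensorProduct

variable {k A : Type*} [CommRing k] [Ring A] [Algebra k A]

/-- Derivations of an associative algebra that need not be commutative, as opposed to
`Derivation`. -/
def IsDerivation (δ : Module.End k A) : Prop :=
  ∀ a b, δ (a * b) = δ a * b + a * δ b

namespace IsDerivation

variable {δ : Module.End k A}

theorem map_one_eq_zero (hδ : IsDerivation δ) : δ 1 = 0 := by
  simpa using hδ 1 1

theorem map_algebraMap_eq_zero (hδ : IsDerivation δ) (r : k) : δ (algebraMap k A r) = 0 := by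
  rw [Algebra.algebraMap_eq_smul_one, map_smul, hδ.map_one_eq_zero, smul_zero]

theorem rTensor_add_lTensor (hδ : IsDerivation δ) :
    IsDerivation (δ.rTensor A + δ.lTensor A : Module.End k (A ⊗[k] A)) := by
  intro s t
  induction s using TensorProduct.induction_on with
  | zero => simp
  | add s s' hs hs' => simp only [add_mul, map_add, hs, hs']; abel
  | tmul a b =>
    induction t using TensorProduct.induction_on with
    | zero => simp
    | add t t' ht ht' => simp only [mul_add, map_add, ht, ht']; abel
    | tmul c d =>
      simp only [LinearMap.add_apply, Algebra.TensorProduct.tmul_mul_tmul, LinearMap.rTensor_tmul,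
        LinearMap.lTensor_tmul, hδ a c, hδ b d, TensorProduct.add_tmul, TensorProduct.tmul_add,
        add_mul, mul_add]
      abel

end IsDerivation

end Derivation

section EnvelopingAlgebra

open UniversalEnvelopingAlgebra

variable {k L : Type*} [CommRing k] [LieRing L] [LieAlgebra k L]

local notation "𝓤" => UniversalEnvelopingAlgebra

theorem enveloping_induction_left {p : 𝓤 k L → Prop} (one : p 1)
    (smul : ∀ (c : k) a, p a → p (c • a)) (add : ∀ a b, p a → p b → p (a + b))
    (ι_mul : ∀ x a, p a → p (ι k x * a)) (a : 𝓤 k L) : p a := by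
  suffices h : ∀ b, p b → p (a * b) by simpa only [mul_one] using h 1 one
  induction a using induct with
  | algMap r => intro b hb; rw [← Algebra.smul_def]; exact smul r b hb
  | gen x => exact ι_mul x
  | mul a b ha hb => intro c hc; rw [mul_assoc]; exact ha _ (hb _ hc)
  | add a b ha hb => intro c hc; rw [add_mul]; exact add _ _ (ha _ hc) (hb _ hc)

theorem enveloping_induction_right {p : 𝓤 k L → Prop} (one : p 1)
    (smul : ∀ (c : k) a, p a → p (c • a)) (add : ∀ a b, p a → p b → p (a + b))
    (mul_ι : ∀ a x, p a → p (a * ι k x)) (a : 𝓤 k L) : p a := by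
  suffices h : ∀ b, p b → p (b * a) by simpa only [one_mul] using h 1 one
  induction a using induct with
  | algMap r => intro b hb; rw [← Algebra.commutes, ← Algebra.smul_def]; exact smul r b hb
  | gen x => exact fun b => mul_ι b x
  | mul a b ha hb => intro c hc; rw [← mul_assoc]; exact hb _ (ha _ hc)
  | add a b ha hb => intro c hc; rw [mul_add]; exact add _ _ (ha _ hc) (hb _ hc)

theorem isPrimitiveElem_ι (x : L) : IsPrimitiveElem k (ι k x) :=
  comul_ι k L x

theorem isDerivation_extDer (D : LieDerivation k L L) : IsDerivation (extDer D) :=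
  extDer_mul D

theorem IsDerivation.isCoderivation {δ : Module.End k (𝓤 k L)} (hδ : IsDerivation δ)
    (hprim : ∀ x : L, IsPrimitiveElem k (δ (ι k x))) : IsCoderivation δ := by
  intro a
  induction a using induct with
  | algMap r =>
    simp [hδ.map_algebraMap_eq_zero, Algebra.TensorProduct.algebraMap_apply, hδ.map_one_eq_zero]
  | gen x =>
    rw [comul_ι]
    simp only [map_add, LinearMap.rTensor_tmul, LinearMap.lTensor_tmul, hδ.map_one_eq_zero,
      TensorProduct.zero_tmul, TensorProduct.tmul_zero, add_zero, zero_add]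
    exact hprim x
  | add a b ha hb => simp only [map_add, ha, hb]; abel
  | mul a b ha hb =>
    rw [hδ, map_add, Bialgebra.comul_mul, Bialgebra.comul_mul, ha, hb, Bialgebra.comul_mul]
    exact (hδ.rTensor_add_lTensor _ _).symm

theorem isCoderivation_extDer (D : LieDerivation k L L) : IsCoderivation (extDer D) :=
  (isDerivation_extDer D).isCoderivation fun x => by
    rw [extDer_ι]; exact isPrimitiveElem_ι (D x)

section ModuleBialgebra

section Algebra

variable {A : Type*} [Ring A] [Algebra k A] {act : 𝓤 k L →ₐ[k] Module.End k A}

theorem act_one_of_isDerivation (hder : ∀ x : L, IsDerivation (act (ι k x))) (a : 𝓤 k L) :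
    act a 1 = Coalgebra.counit (R := k) a • (1 : A) := by
  induction a using enveloping_induction_right with
  | one => simp
  | smul c a ha => simp [ha, mul_smul]
  | add a b ha hb => simp [ha, hb, add_smul]
  | mul_ι a x _ =>
    rw [map_mul, Module.End.mul_apply, (hder x).map_one_eq_zero, map_zero, Bialgebra.counit_mul,
      counit_ι, mul_zero, zero_smul]

theorem act_mul_of_isDerivation (hder : ∀ x : L, IsDerivation (act (ι k x))) (a : 𝓤 k L) (b c : A) :
    act a (b * c) = sweedler ((LinearMap.mul k A).compl₁₂ (act.toLinearMap.flip b)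
      (act.toLinearMap.flip c)) a := by
  induction a using enveloping_induction_right generalizing b c with
  | one => simp [sweedler_one]
  | smul r a ha => simp only [map_smul, LinearMap.smul_apply, ha]
  | add a a' ha ha' => simp only [map_add, LinearMap.add_apply, ha, ha']
  | mul_ι a x ha =>
    rw [map_mul act, Module.End.mul_apply, hder x, map_add, ha, ha,
      ← LinearMap.mulRight_apply (R := k),
      (isPrimitiveElem_ι x).isCoderivation_mulRight.sweedler_apply]
    congr 3 <;>
    · ext p q
      simp [-ι_apply]

end Algebra

section Coalgebra

variable {C : Type*} [AddCommGroup C] [Module k C] [Coalgebra k C]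
  {act : 𝓤 k L →ₐ[k] Module.End k C}

theorem counit_act_of_isCoderivation (hcoder : ∀ x : L, IsCoderivation (act (ι k x))) (a : 𝓤 k L)
    (b : C) : Coalgebra.counit (R := k) (act a b) =
      Coalgebra.counit (R := k) a * Coalgebra.counit (R := k) b := by
  induction a using enveloping_induction_left with
  | one => simp
  | smul c a ha => simp [ha, mul_assoc]
  | add a a' ha ha' => simp only [map_add, LinearMap.add_apply, ha, ha', add_mul]
  | ι_mul x a _ =>
    rw [map_mul, Module.End.mul_apply, (hcoder x).counit_apply, Bialgebra.counit_mul, counit_ι,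
      zero_mul, zero_mul]

theorem comul_act_of_isCoderivation (hcoder : ∀ x : L, IsCoderivation (act (ι k x))) (a : 𝓤 k L)
    (b : C) : Coalgebra.comul (R := k) (act a b) =
      Module.endTensorEndAlgHom (R := k) (S := k) (A := k)
        (Algebra.TensorProduct.map act act (Coalgebra.comul (R := k) a))
        (Coalgebra.comul (R := k) b) := by
  induction a using enveloping_induction_left with
  | one => simp [-Algebra.TensorProduct.map_tmul]
  | smul c a ha => simp only [map_smul, LinearMap.smul_apply, ha]
  | add a a' ha ha' => simp only [map_add, LinearMap.add_apply, ha, ha']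
  | ι_mul x a ha =>
    rw [map_mul, Module.End.mul_apply, hcoder x, ha, Bialgebra.comul_mul, map_mul, map_mul,
      Module.End.mul_apply, comul_ι]
    simp only [map_add, Algebra.TensorProduct.map_tmul, map_one, Module.endTensorEndAlgHom_apply]
    rfl

end Coalgebra

variable {K : Type*} [Ring K] [Bialgebra k K] {act : 𝓤 k L →ₐ[k] Module.End k K}

theorem isModuleBialgebra_of_isDerivation_of_isCoderivation
    (hder : ∀ x : L, IsDerivation (act (ι k x))) (hcoder : ∀ x : L, IsCoderivation (act (ι k x))) :
    IsModuleBialgebra act where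
  act_mul := act_mul_of_isDerivation hder
  act_one := act_one_of_isDerivation hder
  isCoalgHom := by
    refine ⟨TensorProduct.ext' fun a b => ?_, TensorProduct.ext' fun a b => ?_⟩
    · simp [counit_act_of_isCoderivation hcoder, mul_comm]
    · simp only [LinearMap.comp_apply, TensorProduct.comul_tmul, TensorProduct.lift.tmul,
        AlgHom.toLinearMap_apply, comul_act_of_isCoderivation hcoder]
      induction Coalgebra.comul (R := k) a using TensorProduct.induction_on with
      | zero => simp
      | add x y hx hy => simp only [TensorProduct.add_tmul, map_add, hx, hy, LinearMap.add_apply]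
      | tmul x y =>
        induction Coalgebra.comul (R := k) b using TensorProduct.induction_on with
        | zero => simp
        | add s t hs ht => simp only [TensorProduct.tmul_add, map_add, hs, ht]
        | tmul s t => rfl

theorem isModuleBialgebra_extAction {M : Type*} [LieRing M] [LieAlgebra k M]
    (φ : L →ₗ⁅k⁆ LieDerivation k M M) : IsModuleBialgebra (extAction φ) :=
  isModuleBialgebra_of_isDerivation_of_isCoderivation
    (fun x => by rw [extAction_ι]; exact isDerivation_extDer (φ x))
    (fun x => by rw [extAction_ι]; exact isCoderivation_extDer (φ x))

end ModuleBialgebra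

section Subadjacent

variable {V : Type*} [AddCommGroup V] [Module k V]

/-- The operator `u ↦ y u + D_y(u)` of `𝓤 k L`, for `y ∈ L` and a family `D` of derivations of `L`.
When `D` comes from a post-Lie structure this is left multiplication by `y` in the sub-adjacent
associative product of `𝓤 k L`. -/
noncomputable def subadjacentMulLeft (D : L → LieDerivation k L L) (y : L) : Module.End k (𝓤 k L) :=
  LinearMap.mulLeft k (ι k y) + extDer (D y)

theorem subadjacentMulLeft_apply (D : L → LieDerivation k L L) (y : L) (u : 𝓤 k L) :
    subadjacentMulLeft D y u = ι k y * u + extDer (D y) u := rfl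

theorem isCoderivation_subadjacentMulLeft (D : L → LieDerivation k L L) (y : L) :
    IsCoderivation (subadjacentMulLeft D y) :=
  (isPrimitiveElem_ι y).isCoderivation_mulLeft.add (isCoderivation_extDer (D y))

/-- A submodule of `𝓤 k L` stable under all derivations that come from `L`. -/
def IsDerStable (W : Submodule k (𝓤 k L)) : Prop :=
  ∀ D : LieDerivation k L L, W ≤ W.comap (extDer D)

namespace IsDerStable

variable {W W' : Submodule k (𝓤 k L)}

theorem span_one : IsDerStable (Submodule.span k {(1 : 𝓤 k L)}) := by
  intro D
  rw [Submodule.span_singleton_le_iff_mem, Submodule.mem_comap, extDer_one]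
  exact Submodule.zero_mem _

theorem sup (hW : IsDerStable W) (hW' : IsDerStable W') : IsDerStable (W ⊔ W') := fun D =>
  sup_le ((hW D).trans (Submodule.comap_mono le_sup_left))
    ((hW' D).trans (Submodule.comap_mono le_sup_right))

theorem range_ι_mul (hW : IsDerStable W) :
    IsDerStable (LinearMap.range (ι k : L →ₗ⁅k⁆ 𝓤 k L).toLinearMap * W) := by
  intro D
  rw [Submodule.mul_le]
  rintro _ ⟨z, rfl⟩ w hw
  rw [Submodule.mem_comap, LieHom.coe_toLinearMap, extDer_mul, extDer_ι]
  exact add_mem (Submodule.mul_mem_mul ⟨D z, rfl⟩ hw) (Submodule.mul_mem_mul ⟨z, rfl⟩ (hW D hw))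

end IsDerStable

/-- Derivations do not raise the degree, so `D_y` only corrects the leading term `y u` by terms
that have already been reached. -/
theorem eq_top_of_subadjacentMulLeft_mem {D : L → LieDerivation k L L} {S : Submodule k (𝓤 k L)}
    (one_mem : 1 ∈ S) (mem : ∀ y, ∀ u ∈ S, subadjacentMulLeft D y u ∈ S) : S = ⊤ := by
  suffices h : ∀ u, ∃ W : Submodule k (𝓤 k L), IsDerStable W ∧ W ≤ S ∧ u ∈ W from
    eq_top_iff.mpr fun u _ => let ⟨_, _, hWS, hu⟩ := h u; hWS hu
  intro u
  induction u using enveloping_induction_left with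
  | one =>
    exact ⟨_, .span_one, (Submodule.span_singleton_le_iff_mem _ _).mpr one_mem,
      Submodule.mem_span_singleton_self 1⟩
  | smul c u hu =>
    obtain ⟨W, hW, hWS, hu⟩ := hu
    exact ⟨W, hW, hWS, W.smul_mem c hu⟩
  | add u v hu hv =>
    obtain ⟨W, hW, hWS, hu⟩ := hu
    obtain ⟨W', hW', hWS', hv⟩ := hv
    exact ⟨W ⊔ W', hW.sup hW', sup_le hWS hWS', add_mem (Submodule.mem_sup_left hu)
      (Submodule.mem_sup_right hv)⟩
  | ι_mul y u hu =>
    obtain ⟨W, hW, hWS, hu⟩ := hu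
    refine ⟨_, hW.range_ι_mul, ?_, Submodule.mul_mem_mul ⟨y, rfl⟩ hu⟩
    rw [Submodule.mul_le]
    rintro _ ⟨z, rfl⟩ w hw
    have h : ι k z * w = subadjacentMulLeft D z w - extDer (D z) w := by
      rw [subadjacentMulLeft_apply, add_sub_cancel_right]
    exact h ▸ sub_mem (mem z w (hWS hw)) (hWS (hW _ hw))

theorem linearMap_ext_of_subadjacentMulLeft {D : L → LieDerivation k L L} {f g : 𝓤 k L →ₗ[k] V}
    (one : f 1 = g 1) (mulLeft : ∀ y u, f u = g u →
      f (subadjacentMulLeft D y u) = g (subadjacentMulLeft D y u)) : f = g := by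
  have h : LinearMap.eqLocus f g = ⊤ := eq_top_of_subadjacentMulLeft_mem one mulLeft
  exact LinearMap.ext fun u => h.ge (Submodule.mem_top (x := u))

end Subadjacent

section Coinduction

variable {𝔤 𝔥 V : Type*} [LieRing 𝔤] [LieAlgebra k 𝔤] [LieRing 𝔥] [LieAlgebra k 𝔥]
  [AddCommGroup V] [Module k V]

/-- The action of `L` on `Hom(U(L), V)` given by `(z · Ψ)(x) = z · Ψ(x) - Ψ(z x)`, for a
representation `ρ` of `L` on `V`. -/
noncomputable def homAction (ρ : L →ₗ⁅k⁆ Module.End k V) :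
    L →ₗ⁅k⁆ Module.End k (𝓤 k L →ₗ[k] V) where
  toFun z := (ρ z).compRight k - LinearMap.lcomp k V (LinearMap.mulLeft k (ι k z))
  map_add' z z' := by
    ext
    simp only [map_add, LinearMap.sub_apply, LinearMap.compRight_apply, LinearMap.comp_apply,
      LinearMap.add_apply, LinearMap.lcomp_apply, LinearMap.mulLeft_apply, add_mul]
    abel
  map_smul' c z := by ext; simp [-ι_apply, smul_sub]
  map_lie' {z z'} := by
    ext
    simp only [LieHom.map_lie, LieRing.of_associative_ring_bracket, LinearMap.sub_apply,
      LinearMap.compRight_apply, LinearMap.comp_apply, Module.End.mul_apply,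
      LinearMap.lcomp_apply, LinearMap.mulLeft_apply, sub_mul, mul_assoc, map_sub]
    abel

theorem homAction_apply (ρ : L →ₗ⁅k⁆ Module.End k V) (z : L) (Ψ : 𝓤 k L →ₗ[k] V) (x : 𝓤 k L) :
    homAction ρ z Ψ x = ρ z (Ψ x) - Ψ (ι k z * x) := rfl

theorem homAction_comp_mulRight (ρ : L →ₗ⁅k⁆ Module.End k V) (z : L) (Ψ : 𝓤 k L →ₗ[k] V)
    (w : 𝓤 k L) : homAction ρ z Ψ ∘ₗ LinearMap.mulRight k w =
      homAction ρ z (Ψ ∘ₗ LinearMap.mulRight k w) := by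
  ext x
  simp [homAction_apply, mul_assoc]

/-- The action of `U(𝔤)` on the module `𝔥` that extends an action `φ` of `𝔤` by derivations. -/
noncomputable def derAction (φ : 𝔤 →ₗ⁅k⁆ LieDerivation k 𝔥 𝔥) : 𝓤 k 𝔤 →ₐ[k] Module.End k 𝔥 :=
  lift k ((LieDerivation.toLinearMapLieHom k 𝔥).comp φ)

theorem derAction_ι (φ : 𝔤 →ₗ⁅k⁆ LieDerivation k 𝔥 𝔥) (z : 𝔤) (y : 𝔥) :
    derAction φ (ι k z) y = φ z y := by
  rw [derAction, lift_ι_apply]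
  rfl

variable (φ : 𝔤 →ₗ⁅k⁆ LieDerivation k 𝔥 𝔥) (T : 𝔥 →ₗ[k] 𝔤) (ρ : 𝔤 →ₗ⁅k⁆ Module.End k V)

/-- The operators `(L_y Ψ)(x) = (T(x₁ ⇀ y) · Ψ)(x₂)` on `Hom(U(𝔤), V)`, with the action of
`homAction` on the right-hand side. -/
noncomputable def coindOp : 𝔥 →ₗ[k] Module.End k (𝓤 k 𝔤 →ₗ[k] V) :=
  LinearMap.mk₂ k
    (fun y Ψ => sweedler
      ((homAction ρ).toLinearMap.flip Ψ ∘ₗ T ∘ₗ (derAction φ).toLinearMap.flip y))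
    (fun y y' Ψ => by simp only [map_add, LinearMap.comp_add, sweedler_add])
    (fun c y Ψ => by simp only [map_smul, LinearMap.comp_smul, ← sweedlerHom_apply])
    (fun y Ψ Ψ' => by simp only [map_add, LinearMap.add_comp, sweedler_add])
    (fun c y Ψ => by simp only [map_smul, LinearMap.smul_comp, ← sweedlerHom_apply])

variable (y : 𝔥) (Ψ : 𝓤 k 𝔤 →ₗ[k] V) (z : 𝔤)

theorem coindOp_apply_one : coindOp φ T ρ y Ψ 1 = homAction ρ (T y) Ψ 1 := by
  refine (sweedler_one _).trans ?_
  simp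

theorem coindOp_comp_mulRight_ι : coindOp φ T ρ y Ψ ∘ₗ LinearMap.mulRight k (ι k z) =
    coindOp φ T ρ (φ z y) Ψ + coindOp φ T ρ y (Ψ ∘ₗ LinearMap.mulRight k (ι k z)) := by
  refine LinearMap.ext fun x => ?_
  refine ((isPrimitiveElem_ι z).isCoderivation_mulRight.sweedler_apply _ x).trans ?_
  congr 3
  · refine LinearMap.ext₂ fun p q => ?_
    simp [derAction_ι, -ι_apply]
  · refine LinearMap.ext₂ fun p q => ?_
    exact LinearMap.congr_fun (homAction_comp_mulRight ρ (T (derAction φ p y)) Ψ (ι k z)) q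

theorem coindOp_apply_mul_ι (x : 𝓤 k 𝔤) : coindOp φ T ρ y Ψ (x * ι k z) =
    coindOp φ T ρ (φ z y) Ψ x + coindOp φ T ρ y (Ψ ∘ₗ LinearMap.mulRight k (ι k z)) x :=
  LinearMap.congr_fun (coindOp_comp_mulRight_ι φ T ρ y Ψ z) x

theorem coindOp_coindOp_apply_one (a b : 𝔥) : coindOp φ T ρ a (coindOp φ T ρ b Ψ) 1 =
    homAction ρ (T a) (homAction ρ (T b) Ψ) 1 - homAction ρ (T (φ (T a) b)) Ψ 1 := by
  have hb : coindOp φ T ρ b Ψ (ι k (T a)) =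
      homAction ρ (T (φ (T a) b)) Ψ 1 + homAction ρ (T b) Ψ (ι k (T a)) := by
    rw [← one_mul (ι k (T a)), coindOp_apply_mul_ι, coindOp_apply_one, coindOp_apply_one,
      ← homAction_comp_mulRight, LinearMap.comp_apply, LinearMap.mulRight_apply]
  rw [coindOp_apply_one, homAction_apply, mul_one, coindOp_apply_one, hb,
    homAction_apply ρ (T a), mul_one, sub_sub, add_comm]

variable {φ T}

theorem coindOp_lie (hT : IsLieRelRotaBaxter φ T) (a b : 𝔥) :
    coindOp φ T ρ ⁅a, b⁆ = ⁅coindOp φ T ρ a, coindOp φ T ρ b⁆ := by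
  suffices h : ∀ (x : 𝓤 k 𝔤) (a b : 𝔥) (Ψ : 𝓤 k 𝔤 →ₗ[k] V), coindOp φ T ρ ⁅a, b⁆ Ψ x =
      coindOp φ T ρ a (coindOp φ T ρ b Ψ) x - coindOp φ T ρ b (coindOp φ T ρ a Ψ) x from
    LinearMap.ext₂ fun Ψ x => h x a b Ψ
  intro x
  induction x using enveloping_induction_right with
  | one =>
    intro a b Ψ
    have hab : T ⁅a, b⁆ = ⁅T a, T b⁆ - T (φ (T a) b) + T (φ (T b) a) := by
      rw [hT, map_add, map_sub]; abel
    rw [coindOp_apply_one, hab, map_add, map_sub, LieHom.map_lie, coindOp_coindOp_apply_one,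
      coindOp_coindOp_apply_one, LieRing.of_associative_ring_bracket]
    simp only [LinearMap.add_apply, LinearMap.sub_apply, Module.End.mul_apply]
    abel
  | smul c x hx => intro a b Ψ; simp only [map_smul, hx, smul_sub]
  | add x x' hx hx' => intro a b Ψ; simp only [map_add, hx, hx']; abel
  | mul_ι x z hx =>
    intro a b Ψ
    simp only [coindOp_apply_mul_ι, coindOp_comp_mulRight_ι, map_add, LinearMap.add_apply, hx,
      LieDerivation.apply_lie_eq_add]
    abel

/-- The representation of `𝔥` on `Hom(U(𝔤), V)` by the operators `coindOp`, as an action of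
`U(𝔥)`. -/
noncomputable def coindRep (hT : IsLieRelRotaBaxter φ T) :
    𝓤 k 𝔥 →ₐ[k] Module.End k (𝓤 k 𝔤 →ₗ[k] V) :=
  lift k { coindOp φ T ρ with map_lie' := coindOp_lie ρ hT _ _ }

theorem coindRep_ι (hT : IsLieRelRotaBaxter φ T) : coindRep ρ hT (ι k y) = coindOp φ T ρ y := by
  rw [coindRep, lift_ι_apply]
  rfl

theorem coindRep_comp_mulRight_ι (hT : IsLieRelRotaBaxter φ T) (u : 𝓤 k 𝔥) :
    coindRep ρ hT u Ψ ∘ₗ LinearMap.mulRight k (ι k z) =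
      coindRep ρ hT (extDer (φ z) u) Ψ + coindRep ρ hT u (Ψ ∘ₗ LinearMap.mulRight k (ι k z)) := by
  induction u using enveloping_induction_left with
  | one => rw [extDer_one, map_zero, map_one]; exact (zero_add _).symm
  | smul c u hu => simp only [map_smul, LinearMap.smul_apply, LinearMap.smul_comp, hu, smul_add]
  | add u v hu hv =>
    simp only [map_add, LinearMap.add_apply, LinearMap.add_comp, hu, hv]
    abel
  | ι_mul y u hu =>
    simp only [map_mul, Module.End.mul_apply, coindRep_ι, coindOp_comp_mulRight_ι, hu, extDer_mul,
      extDer_ι, map_add, LinearMap.add_apply]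
    abel

theorem IsLieRelRotaBaxter.exists_recursion (hT : IsLieRelRotaBaxter φ T) (v : V) :
    ∃ F : 𝓤 k 𝔥 →ₗ[k] V,
      F 1 = v ∧ ∀ y u, F (ι k y * u) = ρ (T y) (F u) - F (extDer (φ (T y)) u) := by
  let Ψ : 𝓤 k 𝔤 →ₗ[k] V := LinearMap.toSpanSingleton k V v ∘ₗ Coalgebra.counit
  have hΨ (z : 𝔤) : Ψ ∘ₗ LinearMap.mulRight k (ι k z) = 0 := by
    ext x
    simp [Ψ, counit_ι, -ι_apply]
  refine ⟨LinearMap.applyₗ 1 ∘ₗ (coindRep ρ hT).toLinearMap.flip Ψ, by simp [Ψ], fun y u => ?_⟩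
  have hcomm := coindRep_comp_mulRight_ι ρ Ψ (T y) hT u
  rw [hΨ, map_zero, add_zero] at hcomm
  calc coindRep ρ hT (ι k y * u) Ψ 1
      = homAction ρ (T y) (coindRep ρ hT u Ψ) 1 := by
        rw [map_mul, Module.End.mul_apply, coindRep_ι, coindOp_apply_one]
    _ = ρ (T y) (coindRep ρ hT u Ψ 1) - coindRep ρ hT (extDer (φ (T y)) u) Ψ 1 := by
        rw [homAction_apply, ← hcomm, LinearMap.comp_apply, LinearMap.mulRight_apply, mul_one,
          one_mul]

end Coinduction

section RecursiveExtension

variable {𝔤 𝔥 : Type*} [LieRing 𝔤] [LieAlgebra k 𝔤] [LieRing 𝔥] [LieAlgebra k 𝔥]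
  {φ : 𝔤 →ₗ⁅k⁆ LieDerivation k 𝔥 𝔥} {T : 𝔥 →ₗ[k] 𝔤} {F G : 𝓤 k 𝔥 →ₗ[k] 𝓤 k 𝔤}

variable (φ T F) in
/-- `F : U(𝔥) → U(𝔤)` is given by the recursion `F(1) = 1`, `F(y u) = T(y) F(u) - F(T(y) ⇀ u)`. -/
structure IsRecursiveExtension : Prop where
  map_one : F 1 = 1
  map_ι_mul : ∀ y u, F (ι k y * u) = ι k (T y) * F u - F (extAction φ (ι k (T y)) u)

namespace IsRecursiveExtension

theorem map_subadjacentMulLeft (hF : IsRecursiveExtension φ T F) (y : 𝔥) (u : 𝓤 k 𝔥) :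
    F (subadjacentMulLeft (fun y => φ (T y)) y u) = ι k (T y) * F u := by
  rw [subadjacentMulLeft_apply, map_add, hF.map_ι_mul, extAction_ι, sub_add_cancel]

theorem unique (hF : IsRecursiveExtension φ T F) (hG : IsRecursiveExtension φ T G) : F = G :=
  linearMap_ext_of_subadjacentMulLeft (D := fun y => φ (T y)) (hF.map_one.trans hG.map_one.symm)
    fun y u hu => by rw [hF.map_subadjacentMulLeft, hG.map_subadjacentMulLeft, hu]

theorem map_ι (hF : IsRecursiveExtension φ T F) (y : 𝔥) : F (ι k y) = ι k (T y) := by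
  simpa only [mul_one, hF.map_one, extAction_ι, extDer_one, map_zero, sub_zero]
    using hF.map_ι_mul y 1

theorem isCoalgHom (hF : IsRecursiveExtension φ T F) : IsCoalgHom F := by
  constructor
  · refine linearMap_ext_of_subadjacentMulLeft (D := fun y => φ (T y)) ?_ fun y u _ => ?_
    · simp [hF.map_one]
    · rw [(isCoderivation_subadjacentMulLeft _ y).counit_apply, LinearMap.comp_apply,
        hF.map_subadjacentMulLeft, Bialgebra.counit_mul, counit_ι, zero_mul]
  · refine linearMap_ext_of_subadjacentMulLeft (D := fun y => φ (T y)) ?_ fun y u hu => ?_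
    · simp [hF.map_one, Algebra.TensorProduct.one_def]
    · exact (isCoderivation_subadjacentMulLeft _ y).comul_map_apply
        (isPrimitiveElem_ι (T y)).isCoderivation_mulLeft
        (LinearMap.ext (hF.map_subadjacentMulLeft y)) hu

theorem subadjacentMulRight_subadjacentMulLeft (hF : IsRecursiveExtension φ T F) (y : 𝔥)
    (a b : 𝓤 k 𝔥) :
    subadjacentMulRight (extAction φ) F b (subadjacentMulLeft (fun y => φ (T y)) y a) =
      subadjacentMulLeft (fun y => φ (T y)) y (subadjacentMulRight (extAction φ) F b a) := by
  set E : Module.End k (𝓤 k 𝔥) := subadjacentMulLeft (fun y => φ (T y)) y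
  set f := (LinearMap.mul k (𝓤 k 𝔥)).compl₂ ((extAction φ).toLinearMap.flip b ∘ₗ F)
  have hf : f ∘ₗ E + f.compl₂ E = f.compr₂ E := by
    refine LinearMap.ext₂ fun p q => ?_
    change E p * extAction φ (F q) b + p * extAction φ (F (E q)) b = E (p * extAction φ (F q) b)
    rw [hF.map_subadjacentMulLeft, map_mul, Module.End.mul_apply, extAction_ι]
    simp only [E, subadjacentMulLeft_apply, extDer_mul, add_mul, mul_assoc, add_assoc]
  calc sweedler f (E a) = sweedler (f ∘ₗ E + f.compl₂ E) a := by
        rw [(isCoderivation_subadjacentMulLeft _ y).sweedler_apply, sweedler_add]; rfl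
    _ = E (sweedler f a) := by rw [hf, map_sweedler]

theorem map_subadjacentMulRight (hF : IsRecursiveExtension φ T F) (a b : 𝓤 k 𝔥) :
    F (subadjacentMulRight (extAction φ) F b a) = F a * F b := by
  suffices h : F ∘ₗ subadjacentMulRight (extAction φ) F b = LinearMap.mulRight k (F b) ∘ₗ F from
    LinearMap.congr_fun h a
  refine linearMap_ext_of_subadjacentMulLeft (D := fun y => φ (T y)) ?_ fun y u hu => ?_
  · simp [subadjacentMulRight_one, hF.map_one]
  · rw [LinearMap.comp_apply, LinearMap.comp_apply, LinearMap.mulRight_apply] at hu ⊢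
    rw [hF.subadjacentMulRight_subadjacentMulLeft, hF.map_subadjacentMulLeft,
      hF.map_subadjacentMulLeft, hu, mul_assoc]

theorem isRelRotaBaxter (hF : IsRecursiveExtension φ T F) : IsRelRotaBaxter (extAction φ) F where
  isModuleBialgebra := isModuleBialgebra_extAction φ
  isCoalgHom := hF.isCoalgHom
  map_mul_map a b := (hF.map_subadjacentMulRight a b).symm

end IsRecursiveExtension

theorem IsRelRotaBaxter.isRecursiveExtension (hF : IsRelRotaBaxter (extAction φ) F)
    (hι : ∀ y, F (ι k y) = ι k (T y)) : IsRecursiveExtension φ T F where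
  map_one := hF.map_one
  map_ι_mul y u := by rw [hF.map_mul_of_isPrimitiveElem (isPrimitiveElem_ι y), hι]

theorem IsLieRelRotaBaxter.exists_isRecursiveExtension (hT : IsLieRelRotaBaxter φ T) :
    ∃ F, IsRecursiveExtension φ T F := by
  obtain ⟨F, hone, hmul⟩ := hT.exists_recursion
    ((Algebra.lmul k (𝓤 k 𝔤) : 𝓤 k 𝔤 →ₗ⁅k⁆ Module.End k (𝓤 k 𝔤)).comp (ι k)) 1
  exact ⟨F, hone, fun y u => by rw [extAction_ι]; exact hmul y u⟩

end RecursiveExtension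

section PostExtension

variable {p : L →ₗ[k] L →ₗ[k] L} {P Q : 𝓤 k L →ₗ[k] 𝓤 k L →ₗ[k] 𝓤 k L}

namespace IsPostExtension

theorem apply_ι (hP : IsPostExtension p P) {D : L → LieDerivation k L L}
    (hD : ∀ x z, D x z = p x z) (x : L) : P (ι k x) = extDer (D x) := by
  refine LinearMap.ext fun u => ?_
  induction u using enveloping_induction_left with
  | one => rw [hP.ι_one, extDer_one]
  | smul c u hu => rw [map_smul, map_smul, hu]
  | add u v hu hv => rw [map_add, map_add, hu, hv]
  | ι_mul z v hv => rw [hP.ι_mul, extDer_mul, extDer_ι, hD, hv]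

theorem unique (hP : IsPostExtension p P) (hQ : IsPostExtension p Q)
    {D : L → LieDerivation k L L} (hD : ∀ x z, D x z = p x z) : P = Q := by
  have hmul {R : 𝓤 k L →ₗ[k] 𝓤 k L →ₗ[k] 𝓤 k L} (hR : IsPostExtension p R) (y : L) (w : 𝓤 k L) :
      R (subadjacentMulLeft D y w) = extDer (D y) ∘ₗ R w := by
    refine LinearMap.ext fun u => ?_
    rw [subadjacentMulLeft_apply, ← hR.apply_ι hD, map_add, LinearMap.add_apply, hR.mul_left,
      sub_add_cancel, LinearMap.comp_apply]
  refine linearMap_ext_of_subadjacentMulLeft (D := D) ?_ fun y w hw => ?_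
  · exact LinearMap.ext fun u => (hP.one_left u).trans (hQ.one_left u).symm
  · rw [hmul hP, hmul hQ, hw]

end IsPostExtension

variable {𝔤 : Type*} [LieRing 𝔤] [LieAlgebra k 𝔤] {φ : 𝔤 →ₗ⁅k⁆ LieDerivation k L L}
  {T : L →ₗ[k] 𝔤}

theorem IsLieRelRotaBaxter.isPostLie (hT : IsLieRelRotaBaxter φ T) :
    IsPostLie (liePostProduct φ T) where
  lie_right x y z := ((φ (T x)).apply_lie_eq_add y z).trans (add_comm _ _)
  lie_left x y z := by
    change φ (T (⁅x, y⁆ + φ (T x) y - φ (T y) x)) z =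
      φ (T x) (φ (T y) z) - φ (T y) (φ (T x) z)
    rw [add_sub_assoc, add_comm, ← hT, LieHom.map_lie, LieDerivation.lie_apply]

theorem IsRecursiveExtension.isPostExtension {F : 𝓤 k L →ₗ[k] 𝓤 k 𝔤}
    (hF : IsRecursiveExtension φ T F) :
    IsPostExtension (liePostProduct φ T) (hopfPostProduct (extAction φ) F) := by
  have hι (x : L) : hopfPostProduct (extAction φ) F (ι k x) = extDer (φ (T x)) :=
    (congrArg (extAction φ) (hF.map_ι x)).trans (extAction_ι φ (T x))
  exact
  { one_left u := by simp [hopfPostProduct, hF.map_one]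
    ι_one x := by rw [hι, extDer_one]
    ι_mul x z v := by rw [hι, extDer_mul, extDer_ι]; rfl
    mul_left x w u := by
      rw [hι]
      change extAction φ (F (ι k x * w)) u =
        extDer (φ (T x)) (extAction φ (F w) u) - extAction φ (F (extDer (φ (T x)) w)) u
      rw [hF.map_ι_mul, map_sub, map_mul, LinearMap.sub_apply, Module.End.mul_apply, extAction_ι] }

end PostExtension

end EnvelopingAlgebra

theorem mainTheorem7_general {k : Type*} [CommRing k]
    {𝔤 𝔥 : Type*} [LieRing 𝔤] [LieAlgebra k 𝔤] [LieRing 𝔥] [LieAlgebra k 𝔥]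
    (φ : 𝔤 →ₗ⁅k⁆ LieDerivation k 𝔥 𝔥) (T : 𝔥 →ₗ[k] 𝔤) (hT : IsLieRelRotaBaxter φ T) :
    IsModuleBialgebra (UniversalEnvelopingAlgebra.extAction φ) ∧
    IsPostLie (liePostProduct φ T) ∧
    ∃ Tbar : UniversalEnvelopingAlgebra k 𝔥 →ₗ[k] UniversalEnvelopingAlgebra k 𝔤,
      (∀ F : UniversalEnvelopingAlgebra k 𝔥 →ₗ[k] UniversalEnvelopingAlgebra k 𝔤,
        (IsRelRotaBaxter (UniversalEnvelopingAlgebra.extAction φ) F ∧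
          ∀ y : 𝔥, F (UniversalEnvelopingAlgebra.ι k y) =
            UniversalEnvelopingAlgebra.ι k (T y)) ↔ F = Tbar) ∧
      (∀ F : UniversalEnvelopingAlgebra k 𝔥 →ₗ[k] UniversalEnvelopingAlgebra k 𝔤,
        (F 1 = 1 ∧ ∀ (y : 𝔥) (u : UniversalEnvelopingAlgebra k 𝔥),
          F (UniversalEnvelopingAlgebra.ι k y * u) =
            UniversalEnvelopingAlgebra.ι k (T y) * F u -
              F (UniversalEnvelopingAlgebra.extAction φ
                (UniversalEnvelopingAlgebra.ι k (T y)) u)) ↔ F = Tbar) ∧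
      IsPostHopf (hopfPostProduct (UniversalEnvelopingAlgebra.extAction φ) Tbar) ∧
      (∀ P : UniversalEnvelopingAlgebra k 𝔥 →ₗ[k] UniversalEnvelopingAlgebra k 𝔥 →ₗ[k]
          UniversalEnvelopingAlgebra k 𝔥,
        IsPostExtension (liePostProduct φ T) P ↔
          P = hopfPostProduct (UniversalEnvelopingAlgebra.extAction φ) Tbar) := by
  obtain ⟨F₀, hF₀⟩ := hT.exists_isRecursiveExtension
  refine ⟨isModuleBialgebra_extAction φ, hT.isPostLie, F₀, fun F => ⟨fun h => ?_, ?_⟩,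
    fun F => ⟨fun h => ?_, ?_⟩, hF₀.isRelRotaBaxter.isPostHopf, fun P => ⟨fun hP => ?_, ?_⟩⟩
  · exact (h.1.isRecursiveExtension h.2).unique hF₀
  · rintro rfl
    exact ⟨hF₀.isRelRotaBaxter, hF₀.map_ι⟩
  · exact IsRecursiveExtension.unique ⟨h.1, h.2⟩ hF₀
  · rintro rfl
    exact ⟨hF₀.map_one, hF₀.map_ι_mul⟩
  · exact hP.unique hF₀.isPostExtension (D := fun x => φ (T x)) fun _ _ => rfl
  · rintro rfl
    exact hF₀.isPostExtension

theorem mainTheorem7 {k : Type*} [Field k] [IsAlgClosed k] [CharZero k]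
    {𝔤 𝔥 : Type*} [LieRing 𝔤] [LieAlgebra k 𝔤] [LieRing 𝔥] [LieAlgebra k 𝔥]
    (φ : 𝔤 →ₗ⁅k⁆ LieDerivation k 𝔥 𝔥) (T : 𝔥 →ₗ[k] 𝔤) (hT : IsLieRelRotaBaxter φ T) :
    IsModuleBialgebra (UniversalEnvelopingAlgebra.extAction φ) ∧
    IsPostLie (liePostProduct φ T) ∧
    ∃ Tbar : UniversalEnvelopingAlgebra k 𝔥 →ₗ[k] UniversalEnvelopingAlgebra k 𝔤,
      -- `Tbar` is the unique relative Rota–Baxter operator that extends `T`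
      (∀ F : UniversalEnvelopingAlgebra k 𝔥 →ₗ[k] UniversalEnvelopingAlgebra k 𝔤,
        (IsRelRotaBaxter (UniversalEnvelopingAlgebra.extAction φ) F ∧
          ∀ y : 𝔥, F (UniversalEnvelopingAlgebra.ι k y) =
            UniversalEnvelopingAlgebra.ι k (T y)) ↔ F = Tbar) ∧
      -- `Tbar` is the linear map given by the recursion
      (∀ F : UniversalEnvelopingAlgebra k 𝔥 →ₗ[k] UniversalEnvelopingAlgebra k 𝔤,
        (F 1 = 1 ∧ ∀ (y : 𝔥) (u : UniversalEnvelopingAlgebra k 𝔥),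
          F (UniversalEnvelopingAlgebra.ι k y * u) =
            UniversalEnvelopingAlgebra.ι k (T y) * F u -
              F (UniversalEnvelopingAlgebra.extAction φ
                (UniversalEnvelopingAlgebra.ι k (T y)) u)) ↔ F = Tbar) ∧
      -- the operation induced by `Tbar` is a post-Hopf structure on `U(𝔥)`
      IsPostHopf (hopfPostProduct (UniversalEnvelopingAlgebra.extAction φ) Tbar) ∧
      -- and it is the (one and only) extension to `U(𝔥)` of the post-Lie operation induced by `T`
      (∀ P : UniversalEnvelopingAlgebra k 𝔥 →ₗ[k] UniversalEnvelopingAlgebra k 𝔥 →ₗ[k]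
          UniversalEnvelopingAlgebra k 𝔥,
        IsPostExtension (liePostProduct φ T) P ↔
          P = hopfPostProduct (UniversalEnvelopingAlgebra.extAction φ) Tbar) :=
  mainTheorem7_general φ T hT
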